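/- An \emph{interior algebra} is a Boolean algebra $B$ with an operator $g\colon B\to B$ such that $g(a)\le a$, $g(g(a))=g(a)$, $g(a\cdot b)=g(a)\cdot g(b)$ and $g(1)=1$; an element $a$ is \emph{open} if $g(a)=a$. The open elements of $B$ form a Heyting algebra $\mathcal O(B)$, a bounded sublattice of $B$ with implication $a\Rightarrow b=g(-a+b)$. Let $B^*$ denote the (interior) subalgebra of $B$ generated by the open elements of $B$; $B$ is a \emph{$*$-algebra} if $B=B^*$. For a variety $\mathbf V$ of interior algebras (a class closed under homomorphic images, subalgebras and direct products), let $\gamma(\mathbf V)=\{\mathcal O(A): A\in\mathbf V\}$ (up to isomorphism), and let $\mathbf V^*$ be the variety generated by the $*$-algebras in $\mathbf V$. An algebra $P$ is \emph{projective} in a class $\mathbf K$ of algebras if $P\in\mathbf K$ and for all $A,C\in\mathbf K$, every surjective homomorphism $f\colon A\to C$ and every homomorphism $h\colon P\to C$ there is a homomorphism $k\colon P\to A$ with $f\circ k=h$. Let $\mathbf V$ be a variety of interior algebras and $B\in\mathbf V$. Then $\mathcal O(B)$ is projective in $\gamma(\mathbf V)$ if and only if $B^*$ is projective in $\mathbf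 V^*$. -/

import Mathlib

universe u v

/-- An interior algebra: a Boolean algebra with an interior operator `g`. -/
class InteriorAlgebra (α : Type u) extends BooleanAlgebra α where
  /-- the interior operator -/
  g : α → α
  g_le : ∀ a, g a ≤ a
  g_g : ∀ a, g (g a) = g a
  g_inf : ∀ a b, g (a ⊓ b) = g a ⊓ g b
  g_top : g ⊤ = ⊤

namespace InteriorAlgebra

theorem g_mono {α : Type u} [InteriorAlgebra α] {a b : α} (h : a ≤ b) : g a ≤ g b := by
  rw [← inf_eq_left, ← g_inf, inf_eq_left.mpr h]

/-- Direct products of interior algebras, with pointwise operations. -/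
instance instPi {ι : Type v} (A : ι → Type u) [∀ i, InteriorAlgebra (A i)] :
    InteriorAlgebra (∀ i, A i) where
  g a := fun i => g (a i)
  g_le a := fun i => g_le (a i)
  g_g a := funext fun i => g_g (a i)
  g_inf a b := funext fun i => g_inf (a i) (b i)
  g_top := funext fun _ => g_top

end InteriorAlgebra

open InteriorAlgebra in
/-- Homomorphisms of interior algebras. (Complements are preserved automatically by a
`BoundedLatticeHom` between Boolean algebras.) -/
structure InteriorHom (α : Type u) (β : Type v) [InteriorAlgebra α] [InteriorAlgebra β]
    extends BoundedLatticeHom α β where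
  map_g' : ∀ a, toFun (g a) = g (toFun a)

instance InteriorHom.instFunLike (α : Type u) (β : Type v) [InteriorAlgebra α]
    [InteriorAlgebra β] : FunLike (InteriorHom α β) α β where
  coe f := f.toFun
  coe_injective f h e := by
    obtain ⟨f, _⟩ := f
    obtain ⟨h, _⟩ := h
    have : f = h := DFunLike.coe_injective e
    subst this
    rfl

open InteriorAlgebra in
/-- Subalgebras of an interior algebra. -/
structure InteriorSubalgebra (α : Type u) [InteriorAlgebra α] extends BooleanSubalgebra α where
  g_mem' : ∀ {a}, a ∈ carrier → g a ∈ carrier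

namespace InteriorSubalgebra

open InteriorAlgebra

variable {α : Type u} [InteriorAlgebra α]

instance instSetLike : SetLike (InteriorSubalgebra α) α where
  coe S := S.carrier
  coe_injective S T h := by
    obtain ⟨S, _⟩ := S
    obtain ⟨T, _⟩ := T
    have : S = T := SetLike.coe_injective h
    subst this
    rfl

/-- A subalgebra is an interior algebra under the restricted operations. -/
instance instInteriorAlgebra (S : InteriorSubalgebra α) : InteriorAlgebra S where
  toBooleanAlgebra := BooleanSubalgebra.instBooleanAlgebraCoe S.toBooleanSubalgebra
  g a := ⟨g a.1, S.g_mem' a.2⟩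
  g_le a := g_le a.1
  g_g a := Subtype.ext (g_g a.1)
  g_inf a b := Subtype.ext (g_inf a.1 b.1)
  g_top := Subtype.ext g_top

/-- The subalgebra generated by a set: the intersection of all subalgebras containing it. -/
def closure (s : Set α) : InteriorSubalgebra α where
  carrier := {x | ∀ S : InteriorSubalgebra α, s ⊆ S → x ∈ S}
  supClosed' := fun _ ha _ hb S hS => S.supClosed' (ha S hS) (hb S hS)
  infClosed' := fun _ ha _ hb S hS => S.infClosed' (ha S hS) (hb S hS)
  compl_mem' := fun ha S hS => S.compl_mem' (ha S hS)
  bot_mem' := fun S _ => S.bot_mem'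
  g_mem' := fun ha S hS => S.g_mem' (ha S hS)

end InteriorSubalgebra

namespace InteriorAlgebra

variable (α : Type u) [InteriorAlgebra α]

/-- The bounded sublattice of open elements, i.e. of those `a` with `g a = a`. -/
def openElements : Sublattice α where
  carrier := {a | g a = a}
  supClosed' := by
    intro a ha b hb
    refine le_antisymm (g_le _) (sup_le ?_ ?_)
    · exact (Eq.ge ha).trans (g_mono le_sup_left)
    · exact (Eq.ge hb).trans (g_mono le_sup_right)
  infClosed' := by
    intro a ha b hb
    change g (a ⊓ b) = a ⊓ b
    rw [g_inf, show g a = a from ha, show g b = b from hb]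

instance instBoundedOrderOpen : BoundedOrder (openElements α) where
  top := ⟨⊤, g_top⟩
  bot := ⟨⊥, le_bot_iff.mp (g_le ⊥)⟩
  le_top a := (le_top : a.1 ≤ ⊤)
  bot_le a := (bot_le : ⊥ ≤ a.1)

/-- The open elements form a Heyting algebra with `a ⇨ b = g (aᶜ ⊔ b)`. -/
instance instHeytingAlgebraOpen : HeytingAlgebra (openElements α) :=
  HeytingAlgebra.ofHImp (fun a b => ⟨g (a.1ᶜ ⊔ b.1), g_g _⟩) (by
    intro a b c
    change a.1 ≤ g (b.1ᶜ ⊔ c.1) ↔ a.1 ⊓ b.1 ≤ c.1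
    have key : a.1 ≤ b.1ᶜ ⊔ c.1 ↔ a.1 ⊓ b.1 ≤ c.1 := by
      rw [sup_comm, ← himp_eq, le_himp_iff]
    rw [← key]
    refine ⟨fun h => h.trans (g_le _), fun h => ?_⟩
    exact (Eq.ge a.2).trans (g_mono h))

/-- `B*`: the subalgebra of `B` generated by the open elements of `B`. -/
def star : InteriorSubalgebra α := InteriorSubalgebra.closure (openElements α : Set α)

/-- A `*`-algebra is an interior algebra generated by its open elements. -/
def IsStarAlgebra : Prop := ∀ a : α, a ∈ star α

end InteriorAlgebra

/-- Bundled interior algebras. -/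
structure InteriorAlg where
  carrier : Type u
  [str : InteriorAlgebra carrier]

attribute [instance] InteriorAlg.str

instance : CoeSort InteriorAlg.{u} (Type u) := ⟨InteriorAlg.carrier⟩

/-- The functor `𝒪` on objects: the Heyting algebra of open elements. -/
def InteriorAlg.O (B : InteriorAlg.{u}) : HeytAlg.{u} := HeytAlg.of (InteriorAlgebra.openElements B)

/-- `B*` as an interior algebra. -/
def InteriorAlg.star (B : InteriorAlg.{u}) : InteriorAlg.{u} := ⟨InteriorAlgebra.star B⟩

/-- A variety of interior algebras: a class of interior algebras closed under homomorphic images,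
subalgebras and direct products (the empty product included). -/
structure IsInteriorVariety (V : InteriorAlg.{u} → Prop) : Prop where
  image : ∀ (A C : InteriorAlg.{u}) (f : InteriorHom A C), Function.Surjective f → V A → V C
  subalgebra : ∀ (A : InteriorAlg.{u}) (S : InteriorSubalgebra A), V A → V ⟨S⟩
  product : ∀ (ι : Type u) (A : ι → InteriorAlg.{u}), (∀ i, V (A i)) → V ⟨∀ i, A i⟩

/-- The variety generated by a class of interior algebras. -/
def generatedVariety (K : InteriorAlg.{u} → Prop) : InteriorAlg.{u} → Prop := fun A =>
  ∀ W : InteriorAlg.{u} → Prop, IsInteriorVariety W → (∀ C, K C → W C) → W A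

/-- `V*`: the variety generated by the `*`-algebras in `V`. -/
def starVariety (V : InteriorAlg.{u} → Prop) : InteriorAlg.{u} → Prop :=
  generatedVariety fun A => V A ∧ InteriorAlgebra.IsStarAlgebra A

/-- `γ(V) = {𝒪(A) : A ∈ V}`, up to isomorphism. (An order isomorphism of Heyting algebras is the
same thing as an isomorphism of Heyting algebras.) -/
def gammaClass (V : InteriorAlg.{u} → Prop) : HeytAlg.{u} → Prop := fun L =>
  ∃ A : InteriorAlg.{u}, V A ∧ Nonempty (L ≃o A.O)

/-- `P` is projective in the class `K` of interior algebras: `P ∈ K`, and every homomorphism from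
`P` to a member of `K` lifts along every surjective homomorphism between members of `K`. -/
def InteriorAlg.IsProjectiveIn (K : InteriorAlg.{u} → Prop) (P : InteriorAlg.{u}) : Prop :=
  K P ∧ ∀ A C : InteriorAlg.{u}, K A → K C →
    ∀ f : InteriorHom A C, Function.Surjective f →
      ∀ h : InteriorHom P C, ∃ k : InteriorHom P A, ∀ x, f (k x) = h x

/-- `P` is projective in the class `K` of Heyting algebras: `P ∈ K`, and every homomorphism from
`P` to a member of `K` lifts along every surjective homomorphism between members of `K`. -/
def HeytAlg.IsProjectiveIn (K : HeytAlg.{u} → Prop) (P : HeytAlg.{u}) : Prop :=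
  K P ∧ ∀ A C : HeytAlg.{u}, K A → K C →
    ∀ f : HeytingHom A C, Function.Surjective f →
      ∀ h : HeytingHom P C, ∃ k : HeytingHom P A, ∀ x, f (k x) = h x

/-!
A bounded lattice homomorphism from a bounded sublattice of a Boolean algebra `α` to a Boolean
algebra extends to the Boolean subalgebra generated by the sublattice. If `α` is a `*`-algebra, then
every element is a finite join of differences `a \ b` of open elements, so the interior of every
element is a finite meet of Heyting implications `a ⇨ b`; hence the extension of a Heyting
homomorphism `𝒪(α) → 𝒪(β)` preserves interiors, and it is the only one to do so. Thus `𝒪` is full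
and faithful on homomorphisms out of `*`-algebras. Since `𝒪(B) ≅ 𝒪(B*)`, every member of `γ(V)`
comes from a `*`-algebra, and lifting problems translate back and forth along `𝒪`.
-/

section BooleanExtension

variable {L α β : Type*} [BooleanAlgebra α] [BooleanAlgebra β]

theorem surjective_of_subset_range_of_closure_eq_top {s : Set β}
    (hs : BooleanSubalgebra.closure s = ⊤) (f : BoundedLatticeHom α β) (hf : s ⊆ Set.range f) :
    Function.Surjective f := by
  have hle : BooleanSubalgebra.closure s ≤ BooleanSubalgebra.map f ⊤ :=
    BooleanSubalgebra.closure_le.2 <| by simpa using hf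
  intro b
  obtain ⟨a, -, rfl⟩ := hle (hs ▸ BooleanSubalgebra.mem_top : b ∈ BooleanSubalgebra.closure s)
  exact ⟨a, rfl⟩

theorem boundedLatticeHom_eq_of_eqOn_of_closure_eq_top {s : Set α}
    (hs : BooleanSubalgebra.closure s = ⊤) {f h : BoundedLatticeHom α β} (hfh : Set.EqOn f h s) :
    f = h := by
  ext a
  have ha : a ∈ BooleanSubalgebra.closure s := hs ▸ BooleanSubalgebra.mem_top
  induction ha using BooleanSubalgebra.closure_bot_sup_induction with
  | mem a ha => exact hfh ha
  | bot => rw [map_bot, map_bot]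
  | sup a _ b _ iha ihb => rw [map_sup, map_sup, iha, ihb]
  | compl a _ iha => rw [map_compl', map_compl', iha]

variable [Lattice L] [BoundedOrder L]

@[elab_as_elim]
theorem closure_range_sdiff_sup_induction {f : BoundedLatticeHom L α}
    {p : ∀ x ∈ BooleanSubalgebra.closure (Set.range f), Prop}
    (sdiff : ∀ a b, p (f a \ f b) (BooleanSubalgebra.sdiff_mem
      (BooleanSubalgebra.subset_closure ⟨a, rfl⟩) (BooleanSubalgebra.subset_closure ⟨b, rfl⟩)))
    (sup : ∀ x hx y hy, p x hx → p y hy → p (x ⊔ y) (BooleanSubalgebra.sup_mem hx hy))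
    {x : α} (hx : x ∈ BooleanSubalgebra.closure (Set.range f)) : p x hx := by
  induction x, hx using BooleanSubalgebra.closure_sdiff_sup_induction
    (Sublattice.LatticeHom.range f.toLatticeHom).isSublattice ⟨⊥, map_bot f⟩ ⟨⊤, map_top f⟩ with
  | sdiff x hx y hy =>
    obtain ⟨a, rfl⟩ := hx
    obtain ⟨b, rfl⟩ := hy
    exact sdiff a b
  | sup x hx y hy ihx ihy => exact sup x hx y hy ihx ihy

/-- The pairing of two bounded lattice homomorphisms with a common domain. -/
def boundedLatticeHomProd (ι : BoundedLatticeHom L α) (φ : BoundedLatticeHom L β) :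
    BoundedLatticeHom L (α × β) where
  toFun a := (ι a, φ a)
  map_sup' a b := Prod.ext (map_sup ι a b) (map_sup φ a b)
  map_inf' a b := Prod.ext (map_inf ι a b) (map_inf φ a b)
  map_top' := Prod.ext (map_top ι) (map_top φ)
  map_bot' := Prod.ext (map_bot ι) (map_bot φ)

/-- The Boolean subalgebra of `α × β` generated by the pairs `(ι a, φ a)`. If `ι a ≤ ι b` implies
`φ a ≤ φ b` and the image of `ι` generates `α`, it is the graph of the extension of `φ` along
`ι`. -/
def extensionGraph (ι : BoundedLatticeHom L α) (φ : BoundedLatticeHom L β) :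
    BooleanSubalgebra (α × β) :=
  BooleanSubalgebra.closure (Set.range (boundedLatticeHomProd ι φ))

variable {ι : BoundedLatticeHom L α} {φ : BoundedLatticeHom L β}

theorem mk_mem_extensionGraph (a : L) : (ι a, φ a) ∈ extensionGraph ι φ :=
  BooleanSubalgebra.subset_closure ⟨a, rfl⟩

theorem exists_mem_extensionGraph (hι : BooleanSubalgebra.closure (Set.range ι) = ⊤) (a : α) :
    ∃ b, (a, b) ∈ extensionGraph ι φ := by
  have ha : a ∈ BooleanSubalgebra.closure (Set.range ι) := hι ▸ BooleanSubalgebra.mem_top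
  induction ha using closure_range_sdiff_sup_induction with
  | sdiff a b =>
    exact ⟨φ a \ φ b,
      BooleanSubalgebra.sdiff_mem (mk_mem_extensionGraph a) (mk_mem_extensionGraph b)⟩
  | sup x _ y _ ihx ihy =>
    obtain ⟨b, hb⟩ := ihx
    obtain ⟨c, hc⟩ := ihy
    exact ⟨b ⊔ c, BooleanSubalgebra.sup_mem hb hc⟩

theorem snd_eq_bot_of_mem_extensionGraph (hφ : ∀ a b, ι a ≤ ι b → φ a ≤ φ b) {p : α × β}
    (hp : p ∈ extensionGraph ι φ) (hp₁ : p.1 = ⊥) : p.2 = ⊥ := by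
  induction hp using closure_range_sdiff_sup_induction with
  | sdiff a b => exact sdiff_eq_bot_iff.2 (hφ a b (sdiff_eq_bot_iff.1 hp₁))
  | sup x _ y _ ihx ihy =>
    obtain ⟨hx₁, hy₁⟩ := sup_eq_bot_iff.1 hp₁
    exact sup_eq_bot_iff.2 ⟨ihx hx₁, ihy hy₁⟩

theorem snd_le_snd_of_mem_extensionGraph (hφ : ∀ a b, ι a ≤ ι b → φ a ≤ φ b) {p q : α × β}
    (hp : p ∈ extensionGraph ι φ) (hq : q ∈ extensionGraph ι φ) (hpq : p.1 ≤ q.1) :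
    p.2 ≤ q.2 :=
  sdiff_eq_bot_iff.1 <| snd_eq_bot_of_mem_extensionGraph hφ
    (BooleanSubalgebra.sdiff_mem hp hq) (sdiff_eq_bot_iff.2 hpq)

theorem exists_boundedLatticeHom_comp_eq (hι : BooleanSubalgebra.closure (Set.range ι) = ⊤)
    (hφ : ∀ a b, ι a ≤ ι b → φ a ≤ φ b) : ∃ ψ : BoundedLatticeHom α β, ψ.comp ι = φ := by
  choose ψ hψ using exists_mem_extensionGraph (φ := φ) hι
  have eq_of_mem {a : α} {b : β} (h : (a, b) ∈ extensionGraph ι φ) : ψ a = b :=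
    le_antisymm (snd_le_snd_of_mem_extensionGraph hφ (hψ a) h le_rfl)
      (snd_le_snd_of_mem_extensionGraph hφ h (hψ a) le_rfl)
  let ψHom : BoundedLatticeHom α β :=
    { toFun := ψ
      map_sup' := fun a b => eq_of_mem (BooleanSubalgebra.sup_mem (hψ a) (hψ b))
      map_inf' := fun a b => eq_of_mem (BooleanSubalgebra.inf_mem (hψ a) (hψ b))
      map_top' := eq_of_mem BooleanSubalgebra.top_mem
      map_bot' := eq_of_mem BooleanSubalgebra.bot_mem }
  exact ⟨ψHom, BoundedLatticeHom.ext fun a => eq_of_mem (mk_mem_extensionGraph a)⟩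

end BooleanExtension

/-- The inclusion of a subalgebra, as a homomorphism of the underlying Boolean algebras. -/
def InteriorSubalgebra.subtype {α : Type*} [InteriorAlgebra α] (S : InteriorSubalgebra α) :
    BoundedLatticeHom S α :=
  S.toBooleanSubalgebra.subtype

namespace InteriorAlgebra

variable {α : Type*} [InteriorAlgebra α]

theorem coe_himp_openElements (a b : openElements α) :
    ((a ⇨ b : openElements α) : α) = g ((a : α)ᶜ ⊔ b) := rfl

variable (α) in
/-- The inclusion of the open elements, as a homomorphism of bounded lattices. -/
def openInclusion : BoundedLatticeHom (openElements α) α :=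
  { (openElements α).subtype with
    map_top' := rfl
    map_bot' := rfl }

theorem mem_star_of_mem_openElements {a : α} (ha : a ∈ openElements α) : a ∈ star α :=
  fun _ hS => hS ha

theorem mem_star_iff_mem_closure {a : α} :
    a ∈ star α ↔ a ∈ BooleanSubalgebra.closure (openElements α : Set α) := by
  -- The Boolean closure is closed under `g` because every interior is already a generator.
  let S : InteriorSubalgebra α :=
    { BooleanSubalgebra.closure (openElements α : Set α) with
      g_mem' := fun {b} _ => BooleanSubalgebra.subset_closure (g_g b) }
  have hle : BooleanSubalgebra.closure (openElements α : Set α) ≤ (star α).toBooleanSubalgebra :=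
    BooleanSubalgebra.closure_le.2 fun _ => mem_star_of_mem_openElements
  exact ⟨fun ha => ha S BooleanSubalgebra.subset_closure, fun ha => hle ha⟩

theorem IsStarAlgebra.closure_openElements_eq_top (hα : IsStarAlgebra α) :
    BooleanSubalgebra.closure (openElements α : Set α) = ⊤ :=
  top_le_iff.1 fun a _ => mem_star_iff_mem_closure.1 (hα a)

theorem IsStarAlgebra.closure_range_openInclusion_eq_top (hα : IsStarAlgebra α) :
    BooleanSubalgebra.closure (Set.range (openInclusion α)) = ⊤ :=
  (congrArg _ Subtype.range_coe).trans hα.closure_openElements_eq_top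

variable (α) in
theorem isStarAlgebra_star : IsStarAlgebra (star α) := by
  have hle : BooleanSubalgebra.closure (openElements α : Set α) ≤
      (star (star α)).toBooleanSubalgebra.map (star α).subtype :=
    BooleanSubalgebra.closure_le.2 fun a ha =>
      ⟨⟨a, mem_star_of_mem_openElements ha⟩, mem_star_of_mem_openElements (Subtype.ext ha), rfl⟩
  intro a
  obtain ⟨b, hb, hba⟩ := hle (mem_star_iff_mem_closure.1 a.2)
  exact Subtype.ext hba ▸ hb

variable (α) in
/-- The isomorphism `𝒪(B) ≅ 𝒪(B*)`. -/
def openElementsStarOrderIso : openElements α ≃o openElements (star α) where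
  toFun a := ⟨⟨a, mem_star_of_mem_openElements a.2⟩, Subtype.ext a.2⟩
  invFun a := ⟨a.1, congrArg Subtype.val a.2⟩
  left_inv _ := rfl
  right_inv _ := rfl
  map_rel_iff' := Iff.rfl

end InteriorAlgebra

namespace InteriorHom

open InteriorAlgebra

variable {α β γ : Type*} [InteriorAlgebra α] [InteriorAlgebra β] [InteriorAlgebra γ]

instance instBoundedLatticeHomClass : BoundedLatticeHomClass (InteriorHom α β) α β where
  map_sup f := f.map_sup'
  map_inf f := f.map_inf'
  map_top f := f.map_top'
  map_bot f := f.map_bot'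

theorem map_g (f : InteriorHom α β) (a : α) : f (g a) = g (f a) := f.map_g' a

/-- The composition of two homomorphisms of interior algebras. -/
def comp (f : InteriorHom β γ) (k : InteriorHom α β) : InteriorHom α γ where
  toBoundedLatticeHom := f.toBoundedLatticeHom.comp k.toBoundedLatticeHom
  map_g' a := (congrArg f (k.map_g a)).trans (f.map_g (k a))

/-- The functor `𝒪` on morphisms. -/
def mapOpen (f : InteriorHom α β) : HeytingHom (openElements α) (openElements β) where
  toFun a := ⟨f a, (f.map_g a).symm.trans (congrArg f a.2)⟩
  map_sup' a b := Subtype.ext (map_sup f (a : α) b)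
  map_inf' a b := Subtype.ext (map_inf f (a : α) b)
  map_bot' := Subtype.ext (map_bot f)
  map_himp' a b := Subtype.ext <| by
    simp only [coe_himp_openElements, map_g, map_sup, map_compl']

theorem mapOpen_comp (f : InteriorHom β γ) (k : InteriorHom α β) :
    (f.comp k).mapOpen = f.mapOpen.comp k.mapOpen := rfl

theorem surjective_mapOpen {f : InteriorHom α β} (hf : Function.Surjective f) :
    Function.Surjective f.mapOpen := by
  rintro ⟨b, hb⟩
  obtain ⟨a, rfl⟩ := hf b
  exact ⟨⟨g a, g_g a⟩, Subtype.ext ((f.map_g a).trans hb)⟩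

theorem surjective_of_surjective_mapOpen (hβ : IsStarAlgebra β) {f : InteriorHom α β}
    (hf : Function.Surjective f.mapOpen) : Function.Surjective f := by
  refine surjective_of_subset_range_of_closure_eq_top hβ.closure_openElements_eq_top
    f.toBoundedLatticeHom fun b hb => ?_
  obtain ⟨a, ha⟩ := hf ⟨b, hb⟩
  exact ⟨a, congrArg Subtype.val ha⟩

theorem mapOpen_injective (hα : IsStarAlgebra α) :
    Function.Injective (mapOpen : InteriorHom α β → _) := by
  intro f h hfh
  have hom_eq : f.toBoundedLatticeHom = h.toBoundedLatticeHom :=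
    boundedLatticeHom_eq_of_eqOn_of_closure_eq_top hα.closure_openElements_eq_top
      fun a ha => congrArg Subtype.val (DFunLike.congr_fun hfh (⟨a, ha⟩ : openElements α))
  exact DFunLike.ext f h fun a => DFunLike.congr_fun hom_eq a

theorem map_g_of_map_openElements (hα : IsStarAlgebra α)
    (φ : HeytingHom (openElements α) (openElements β)) (ψ : BoundedLatticeHom α β)
    (hψ : ∀ a : openElements α, ψ a = φ a) (x : α) : ψ (g x) = g (ψ x) := by
  suffices h : ∀ y, ψ (g yᶜ) = g (ψ y)ᶜ by
    simpa only [compl_compl, map_compl'] using h xᶜ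
  intro y
  have hy : y ∈ BooleanSubalgebra.closure (Set.range (openInclusion α)) :=
    hα.closure_range_openInclusion_eq_top ▸ BooleanSubalgebra.mem_top
  induction hy using closure_range_sdiff_sup_induction with
  | sdiff a b =>
    change ψ (g ((a : α) \ b)ᶜ) = g (ψ ((a : α) \ b))ᶜ
    calc ψ (g ((a : α) \ b)ᶜ) = ψ ↑(a ⇨ b) := by
          rw [coe_himp_openElements, sdiff_eq, compl_inf, compl_compl]
      _ = ↑(φ a ⇨ φ b) := by rw [hψ, map_himp]
      _ = g (ψ ((a : α) \ b))ᶜ := by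
          rw [coe_himp_openElements, map_sdiff', hψ, hψ, sdiff_eq, compl_inf, compl_compl]
  | sup x _ y _ ihx ihy => rw [compl_sup, g_inf, map_inf, ihx, ihy, map_sup, compl_sup, g_inf]

theorem exists_mapOpen_eq (hα : IsStarAlgebra α)
    (φ : HeytingHom (openElements α) (openElements β)) :
    ∃ f : InteriorHom α β, f.mapOpen = φ := by
  obtain ⟨ψ, hψ⟩ := exists_boundedLatticeHom_comp_eq hα.closure_range_openInclusion_eq_top
    (φ := (openInclusion β).comp (φ : BoundedLatticeHom (openElements α) (openElements β)))
    fun a b hab => OrderHomClass.mono φ hab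
  have hψ_open (a : openElements α) : ψ a = φ a := DFunLike.congr_fun hψ a
  exact ⟨⟨ψ, map_g_of_map_openElements hα φ ψ hψ_open⟩,
    HeytingHom.ext fun a => Subtype.ext (hψ_open a)⟩

end InteriorHom

theorem heytAlg_isProjectiveIn_of_orderIso {K : HeytAlg.{u} → Prop} {P Q : HeytAlg.{u}}
    (e : P ≃o Q) (hQ : K Q) (hP : HeytAlg.IsProjectiveIn K P) : HeytAlg.IsProjectiveIn K Q := by
  refine ⟨hQ, fun A C hA hC f hf h => ?_⟩
  obtain ⟨k, hk⟩ := hP.2 A C hA hC f hf (h.comp (e : HeytingHom P Q))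
  exact ⟨k.comp (e.symm : HeytingHom Q P),
    fun x => (hk (e.symm x)).trans (congrArg h (e.apply_symm_apply x))⟩

section Varieties

open InteriorAlgebra

variable {V : InteriorAlg.{u} → Prop}

theorem gammaClass_of_orderIso {L M : HeytAlg.{u}} (e : L ≃o M) (hL : gammaClass V L) :
    gammaClass V M := by
  obtain ⟨A, hA, ⟨eA⟩⟩ := hL
  exact ⟨A, hA, ⟨e.symm.trans eA⟩⟩

theorem gammaClass_O {A : InteriorAlg.{u}} (hA : V A) : gammaClass V A.O :=
  ⟨A, hA, ⟨OrderIso.refl _⟩⟩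

theorem starVariety_of_isStarAlgebra {A : InteriorAlg.{u}} (hA : V A) (hstar : IsStarAlgebra A) :
    starVariety V A :=
  fun _ _ hK => hK A ⟨hA, hstar⟩

theorem of_starVariety (hV : IsInteriorVariety V) {A : InteriorAlg.{u}} (hA : starVariety V A) :
    V A :=
  hA V hV fun _ h => h.1

theorem exists_isStarAlgebra_of_gammaClass (hV : IsInteriorVariety V) {L : HeytAlg.{u}}
    (hL : gammaClass V L) :
    ∃ A : InteriorAlg.{u}, V A ∧ IsStarAlgebra A ∧ Nonempty (L ≃o A.O) := by
  obtain ⟨A, hA, ⟨e⟩⟩ := hL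
  exact ⟨A.star, hV.subalgebra A _ hA, isStarAlgebra_star A,
    ⟨e.trans (openElementsStarOrderIso A)⟩⟩

theorem of_gammaClass_O_of_isStarAlgebra (hV : IsInteriorVariety V) {P : InteriorAlg.{u}}
    (hP : IsStarAlgebra P) (hPO : gammaClass V P.O) : V P := by
  obtain ⟨A, hA, hAstar, ⟨e⟩⟩ := exists_isStarAlgebra_of_gammaClass hV hPO
  obtain ⟨F, hF⟩ := InteriorHom.exists_mapOpen_eq hAstar (e.symm : HeytingHom A.O P.O)
  refine hV.image A P F (InteriorHom.surjective_of_surjective_mapOpen hP ?_) hA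
  rw [hF]
  exact e.symm.surjective

theorem isProjectiveIn_starVariety_of_gammaClass_O (hV : IsInteriorVariety V) {P : InteriorAlg.{u}}
    (hP : IsStarAlgebra P) (hproj : HeytAlg.IsProjectiveIn (gammaClass V) P.O) :
    InteriorAlg.IsProjectiveIn (starVariety V) P := by
  have hPV : V P := of_gammaClass_O_of_isStarAlgebra hV hP hproj.1
  refine ⟨starVariety_of_isStarAlgebra hPV hP, fun A C hA hC f hf h => ?_⟩
  obtain ⟨κ, hκ⟩ := hproj.2 A.O C.O (gammaClass_O (of_starVariety hV hA))
    (gammaClass_O (of_starVariety hV hC)) f.mapOpen (InteriorHom.surjective_mapOpen hf) h.mapOpen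
  obtain ⟨k, rfl⟩ := InteriorHom.exists_mapOpen_eq hP κ
  have hfk : f.comp k = h := InteriorHom.mapOpen_injective hP <|
    (InteriorHom.mapOpen_comp f k).trans (HeytingHom.ext hκ)
  exact ⟨k, DFunLike.congr_fun hfk⟩

theorem isProjectiveIn_gammaClass_O_of_starVariety (hV : IsInteriorVariety V) {P : InteriorAlg.{u}}
    (hP : IsStarAlgebra P) (hproj : InteriorAlg.IsProjectiveIn (starVariety V) P) :
    HeytAlg.IsProjectiveIn (gammaClass V) P.O := by
  refine ⟨gammaClass_O (of_starVariety hV hproj.1), fun L M hL hM f hf h => ?_⟩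
  obtain ⟨A, hA, hAstar, ⟨eL⟩⟩ := exists_isStarAlgebra_of_gammaClass hV hL
  obtain ⟨C, hC, hCstar, ⟨eM⟩⟩ := exists_isStarAlgebra_of_gammaClass hV hM
  obtain ⟨F, hF⟩ := InteriorHom.exists_mapOpen_eq hAstar
    ((eM : HeytingHom M C.O).comp (f.comp (eL.symm : HeytingHom A.O L)))
  obtain ⟨H, hH⟩ := InteriorHom.exists_mapOpen_eq hP ((eM : HeytingHom M C.O).comp h)
  have hF_surj : Function.Surjective F := by
    refine InteriorHom.surjective_of_surjective_mapOpen hCstar ?_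
    rw [hF]
    exact eM.surjective.comp (hf.comp eL.symm.surjective)
  obtain ⟨k, hk⟩ := hproj.2 A C (starVariety_of_isStarAlgebra hA hAstar)
    (starVariety_of_isStarAlgebra hC hCstar) F hF_surj H
  have hFk : F.mapOpen.comp k.mapOpen = H.mapOpen :=
    (InteriorHom.mapOpen_comp F k).symm.trans <|
      congrArg InteriorHom.mapOpen (DFunLike.ext (F.comp k) H hk)
  rw [hF, hH] at hFk
  exact ⟨(eL.symm : HeytingHom A.O L).comp k.mapOpen,
    fun x => eM.injective (DFunLike.congr_fun hFk x)⟩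

theorem mainTheorem7_general (hV : IsInteriorVariety V) (B : InteriorAlg.{u}) :
    HeytAlg.IsProjectiveIn (gammaClass V) B.O ↔
      InteriorAlg.IsProjectiveIn (starVariety V) B.star := by
  have hB_star : IsStarAlgebra B.star := isStarAlgebra_star B
  have e : B.O ≃o B.star.O := openElementsStarOrderIso B
  constructor
  · intro hO
    exact isProjectiveIn_starVariety_of_gammaClass_O hV hB_star
      (heytAlg_isProjectiveIn_of_orderIso e (gammaClass_of_orderIso e hO.1) hO)
  · intro hstar
    have hO := isProjectiveIn_gammaClass_O_of_starVariety hV hB_star hstar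
    exact heytAlg_isProjectiveIn_of_orderIso e.symm (gammaClass_of_orderIso e.symm hO.1) hO

end Varieties

theorem mainTheorem7 (V : InteriorAlg.{u} → Prop) (hV : IsInteriorVariety V)
    (B : InteriorAlg.{u}) (hB : V B) :
    HeytAlg.IsProjectiveIn (gammaClass V) B.O ↔
      InteriorAlg.IsProjectiveIn (starVariety V) B.star :=
  mainTheorem7_general hV B
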